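/- Throughout, $\log$ is the logarithm to base $2$ and $\log^{(k)}$ is its $k$-fold iterate, so that $\log^{(1)}=\log$, while $\log^2(x)=(\log x)^2$. Let $A$ and $C$ be positive real constants, and let $\mathcal{F}_{\exp}^{A,C}$ be the class of all entire functions $f$ with $|f(z)|\le C e^{A|z|}$ for all $z\in\mathbb{C}$, equipped with the metric $$d_1(f_1,f_2)=\sup_{|z|<1}|f_1(z)-f_2(z)|.$$ For a metric space $(\mathcal{X},d)$, a subset $\mathcal{K}\subseteq\mathcal{X}$ and $\varepsilon>0$, let $N(\varepsilon;\mathcal{K},d)$ be the smallest number of points $x_1,\dots,x_N\in\mathcal{X}$ such that every $x\in\mathcal{K}$ satisfies $d(x,x_i)\le\varepsilon$ for some $i$, and let $H(\varepsilon;\mathcal{K},d)=\log N(\varepsilon;\mathcal{K},d)$ be the metric entropy of $\mathcal{K}$. Let $\mathcal{X}$ be any metric space that contains $(\mathcal{F}_{\exp}^{A,C},d_1)$ isometrically (for instance this class itself, or the space of all entire functions with the metric $d_1$), and compute covering numbers with centres in $\mathcal{X}$. Then the covering numbers of $\mathcal{F}_{\exp}^{A,C}$ are finite for every $\varepsilon>0$,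 and, as $\varepsilon\to0^+$, $$H\left(\varepsilon;\mathcal{F}_{\exp}^{A,C},d_1\right)=\frac{\log^2(\varepsilon^{-1})}{\log^{(2)}(\varepsilon^{-1})}\left(1+\frac{\log^{(3)}(\varepsilon^{-1})}{\log^{(2)}(\varepsilon^{-1})}+o\left(\frac{\log^{(3)}(\varepsilon^{-1})}{\log^{(2)}(\varepsilon^{-1})}\right)\right).$$ -/

import Mathlib

open Filter Topology Asymptotics

/-- An entire function: a function `ℂ → ℂ` that is complex differentiable everywhere. -/
@[ext]
structure EntireFunction where
  toFun : ℂ → ℂ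
  differentiable : Differentiable ℂ toFun

namespace EntireFunction

/-- The quantity `d_r(f, g) = sup_{z ∈ D(0; r)} |f(z) - g(z)|`, with `D(0; r)` the open disk. -/
noncomputable def diskDist (r : ℝ) (f g : EntireFunction) : ℝ :=
  ⨆ z : Metric.ball (0 : ℂ) r, ‖f.toFun z - g.toFun z‖

theorem bddAbove_diskDist (r : ℝ) (f g : EntireFunction) :
    BddAbove (Set.range fun z : Metric.ball (0 : ℂ) r => ‖f.toFun z - g.toFun z‖) := by
  have hc : Continuous fun z : ℂ => ‖f.toFun z - g.toFun z‖ :=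
    (f.differentiable.continuous.sub g.differentiable.continuous).norm
  obtain ⟨M, hM⟩ := (isCompact_closedBall (0 : ℂ) r).bddAbove_image hc.continuousOn
  refine ⟨M, ?_⟩
  rintro _ ⟨z, rfl⟩
  exact hM ⟨z, Metric.ball_subset_closedBall z.2, rfl⟩

theorem norm_sub_le_diskDist (r : ℝ) (f g : EntireFunction) (z : Metric.ball (0 : ℂ) r) :
    ‖f.toFun z - g.toFun z‖ ≤ diskDist r f g :=
  le_ciSup (bddAbove_diskDist r f g) z

/-- The space of entire functions is equipped with the metric `d_1`. -/
noncomputable instance : MetricSpace EntireFunction where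
  dist f g := diskDist 1 f g
  dist_self f := by simp [diskDist]
  dist_comm f g := by simp only [diskDist, norm_sub_rev]
  dist_triangle f g h := by
    have : Nonempty (Metric.ball (0 : ℂ) 1) := ⟨⟨0, by simp⟩⟩
    refine ciSup_le fun z => ?_
    calc ‖f.toFun z - h.toFun z‖
        ≤ ‖f.toFun z - g.toFun z‖ + ‖g.toFun z - h.toFun z‖ := norm_sub_le_norm_sub_add_norm_sub ..
      _ ≤ _ := add_le_add (norm_sub_le_diskDist 1 f g z) (norm_sub_le_diskDist 1 g h z)
  eq_of_dist_eq_zero {f g} hfg := by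
    have hf : AnalyticOnNhd ℂ f.toFun Set.univ := fun z _ => f.differentiable.analyticAt z
    have hg : AnalyticOnNhd ℂ g.toFun Set.univ := fun z _ => g.differentiable.analyticAt z
    refine EntireFunction.ext (hf.eq_of_eventuallyEq hg (z₀ := 0) ?_)
    filter_upwards [Metric.ball_mem_nhds (0 : ℂ) one_pos] with z hz
    have h1 := norm_sub_le_diskDist 1 f g ⟨z, hz⟩
    have h2 : diskDist 1 f g = 0 := hfg
    rw [h2] at h1
    exact sub_eq_zero.1 (norm_le_zero_iff.1 h1)

end EntireFunction

/-- The class of entire functions of exponential type with constants `A` and `C`: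
all entire `f` with `|f(z)| ≤ C * exp (A * |z|)` for every `z`. -/
def expTypeClass (A C : ℝ) : Set EntireFunction :=
  {f | ∀ z : ℂ, ‖f.toFun z‖ ≤ C * Real.exp (A * ‖z‖)}

/-- The `ε`-covering number of `K ⊆ X`: the least number of closed `ε`-balls with centres in the
ambient space `X` that cover `K`. -/
noncomputable def epsCoveringNumber {X : Type*} [MetricSpace X] (ε : ℝ) (K : Set X) : ℕ∞ :=
  Metric.externalCoveringNumber ε.toNNReal K

/-- The metric entropy of `K ⊆ X`: the logarithm to base `2` of the `ε`-covering number
(meaningful when that number is finite). -/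
noncomputable def metricEntropy {X : Type*} [MetricSpace X] (ε : ℝ) (K : Set X) : ℝ :=
  Real.logb 2 ((epsCoveringNumber ε K).toNat : ℝ)

/-- The `k`-fold iterated logarithm to base `2`. -/
noncomputable def iterLog (k : ℕ) (x : ℝ) : ℝ :=
  (Real.logb 2)^[k] x

/-! On Taylor coefficients the class lies between two explicit boxes. Cauchy's estimate on a circle
of radius `r` gives `|a_k| ≤ C e^{Ar} / r^k`. Conversely, every polynomial with `|a_k| ≤ C A^k / k!`
is in the class. Rounding coefficients on a mesh proportional to `ε / 2^k` gives a cover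
(`epsCoveringNumber_le_prod`), and a grid of mesh `3ε` in the inner box gives a packing
(`prod_le_epsCoveringNumber`).

Write `L`, `l`, `m` for the first three iterated logarithms of `1/ε`. The logarithm of each count is
at heart the sum of an arithmetic progression. The single radius `r = L / l`, of logarithm `l - m`,
gives about `L² / (l - m - 1)` from above. Truncating at `n ≈ L / (l - m)` and using `k! ≤ n^k`
gives about `L² / (l - m)` from below. Both are `L² / l * (1 + m/l + O(1/l))`, and `1/l = o(m/l)`
because `m → ∞`.

The ambient space plays no role: the cover has its centres in the image of the class, and the
packing bound holds for centres anywhere. -/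

/-! ### Taylor coefficients and the metric. -/

/-- The `k`-th Taylor coefficient at the origin. -/
noncomputable def taylorCoeff (f : ℂ → ℂ) (k : ℕ) : ℂ :=
  (k.factorial : ℂ)⁻¹ * iteratedDeriv k f 0

theorem norm_taylorCoeff_le {f : ℂ → ℂ} (hf : Differentiable ℂ f) {r D : ℝ} (hr : 0 < r)
    (hD : ∀ z : ℂ, ‖z‖ = r → ‖f z‖ ≤ D) (k : ℕ) : ‖taylorCoeff f k‖ ≤ D / r ^ k := by
  have h := Complex.norm_iteratedDeriv_le_of_forall_mem_sphere_norm_le (c := 0) k hr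
    hf.diffContOnCl (fun z hz => hD z (by simpa using hz))
  have hk : (0 : ℝ) < k.factorial := by positivity
  rw [taylorCoeff, norm_mul, norm_inv, Complex.norm_natCast, inv_mul_le_iff₀ hk]
  rwa [← mul_div_assoc]

theorem hasSum_taylorCoeff {f : ℂ → ℂ} (hf : Differentiable ℂ f) (z : ℂ) :
    HasSum (fun k => taylorCoeff f k * z ^ k) (f z) := by
  have h := Complex.hasSum_taylorSeries_of_entire hf 0 z
  convert! h using 2 with k
  simp only [taylorCoeff, smul_eq_mul, sub_zero]
  ring

theorem taylorCoeff_sub {f g : ℂ → ℂ} (hf : Differentiable ℂ f) (hg : Differentiable ℂ g) (k : ℕ) :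
    taylorCoeff (f - g) k = taylorCoeff f k - taylorCoeff g k := by
  rw [taylorCoeff, iteratedDeriv_sub hf.contDiff.contDiffAt hg.contDiff.contDiffAt, mul_sub]
  rfl

theorem iteratedDeriv_polynomial_eval (p : Polynomial ℂ) (k : ℕ) :
    iteratedDeriv k (fun z => p.eval z) = fun z => (Polynomial.derivative^[k] p).eval z := by
  induction k with
  | zero => simp
  | succ k ih =>
    rw [iteratedDeriv_succ, ih]
    ext z
    rw [Polynomial.deriv, Function.iterate_succ_apply']

theorem taylorCoeff_polynomial (p : Polynomial ℂ) (k : ℕ) :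
    taylorCoeff (fun z => p.eval z) k = p.coeff k := by
  have hk : (k.factorial : ℂ) ≠ 0 := by exact_mod_cast k.factorial_ne_zero
  rw [taylorCoeff, iteratedDeriv_polynomial_eval]
  simp only
  rw [← Polynomial.coeff_zero_eq_eval_zero, Polynomial.coeff_iterate_derivative]
  simp [Nat.descFactorial_self, hk]

namespace EntireFunction

theorem dist_le_of_hasSum {f g : EntireFunction} {u : ℕ → ℝ} {s : ℝ} (hu : HasSum u s)
    (h : ∀ k, ‖taylorCoeff f.toFun k - taylorCoeff g.toFun k‖ ≤ u k) : dist f g ≤ s := by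
  have : Nonempty (Metric.ball (0 : ℂ) 1) := ⟨⟨0, by simp⟩⟩
  refine ciSup_le fun z => ?_
  have hz : ‖(z : ℂ)‖ ≤ 1 := by simpa using (Metric.mem_ball.1 z.2).le
  have hs := (hasSum_taylorCoeff f.differentiable z).sub (hasSum_taylorCoeff g.differentiable z)
  refine hs.norm_le_of_bounded hu fun k => ?_
  rw [← sub_mul, norm_mul, norm_pow]
  exact (mul_le_of_le_one_right (norm_nonneg _) (pow_le_one₀ (norm_nonneg _) hz)).trans (h k)

theorem norm_taylorCoeff_sub_le_dist (f g : EntireFunction) (k : ℕ) :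
    ‖taylorCoeff f.toFun k - taylorCoeff g.toFun k‖ ≤ dist f g := by
  rw [← taylorCoeff_sub f.differentiable g.differentiable]
  have hc : Continuous fun z : ℂ => ‖f.toFun z - g.toFun z‖ :=
    (f.differentiable.continuous.sub g.differentiable.continuous).norm
  -- Cauchy's estimate needs the unit circle, which the open disk misses; continuity extends the
  -- bound to the closure.
  have hb : Metric.closedBall (0 : ℂ) 1 ⊆ {z : ℂ | ‖f.toFun z - g.toFun z‖ ≤ dist f g} := by
    rw [← closure_ball (0 : ℂ) one_ne_zero]
    exact closure_minimal (fun z hz => norm_sub_le_diskDist 1 f g ⟨z, hz⟩)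
      (isClosed_le hc continuous_const)
  have h := norm_taylorCoeff_le (f.differentiable.sub g.differentiable) one_pos
    (fun z hz => hb (by simp [hz])) k
  simpa using h

end EntireFunction

/-! ### Covering numbers from codes and from separated families. -/

/-- One representative for each code that occurs serves as a centre, so the centres lie in the image
of `F`. -/
theorem epsCoveringNumber_range_le_card {X Y ι : Type*} [MetricSpace X] [Fintype ι] {ε : ℝ}
    (F : Y → X) (c : Y → ι) (h : ∀ x y, c x = c y → dist (F x) (F y) ≤ ε) :
    epsCoveringNumber ε (Set.range F) ≤ Fintype.card ι := by
  have hcover : Metric.IsCover ε.toNNReal (Set.range F)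
      (Set.range fun i : Set.range c => F i.2.choose) := by
    rintro _ ⟨x, rfl⟩
    refine ⟨_, ⟨⟨c x, x, rfl⟩, rfl⟩, ?_⟩
    have hx : c (Exists.choose (⟨x, rfl⟩ : ∃ y, c y = c x)) = c x :=
      Exists.choose_spec (⟨x, rfl⟩ : ∃ y, c y = c x)
    have := h _ _ hx.symm
    change edist _ _ ≤ _
    rw [edist_dist]
    exact ENNReal.ofReal_le_ofReal this
  refine hcover.externalCoveringNumber_le_encard.trans ?_
  rw [← Set.image_univ]
  refine (Set.encard_image_le _ _).trans ?_
  rw [Set.encard_univ, ENat.card_coe_set_eq]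
  refine (Set.encard_le_encard (Set.subset_univ _)).trans ?_
  rw [Set.encard_univ, ENat.card_eq_coe_fintype_card]

theorem card_le_epsCoveringNumber {X ι : Type*} [MetricSpace X] [Fintype ι] {ε : ℝ} (hε : 0 ≤ ε)
    {K : Set X} (F : ι → X) (hF : ∀ i, F i ∈ K) (h : Pairwise fun i j => 2 * ε < dist (F i) (F j)) :
    (Fintype.card ι : ℕ∞) ≤ epsCoveringNumber ε K := by
  refine le_trans ?_ (Metric.packingNumber_two_mul_le_externalCoveringNumber _ _)
  have hinj : Function.Injective F := by
    intro i j hij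
    by_contra hne
    have := h hne
    simp only [hij, dist_self] at this
    linarith
  have hsep : Metric.IsSeparated ((2 * ε.toNNReal : NNReal) : ENNReal) (Set.range F) := by
    rintro _ ⟨i, rfl⟩ _ ⟨j, rfl⟩ hne
    have hij := h (fun hij : i = j => hne (congrArg F hij))
    change _ < edist _ _
    rw [edist_nndist, ENNReal.coe_lt_coe, ← NNReal.coe_lt_coe]
    simpa [hε] using hij
  refine le_trans ?_ (hsep.encard_le_packingNumber (Set.range_subset_iff.2 hF))
  rw [← Set.image_univ, hinj.encard_image, Set.encard_univ, ENat.card_eq_coe_fintype_card]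

/-! ### Product bounds for the covering number. -/

/-- The polynomial with these coefficients is dominated termwise by `C` times a partial sum of the
series of `exp (A * ‖z‖)`. -/
theorem exists_mem_expTypeClass_taylorCoeff_eq {A C : ℝ} (hA : 0 < A) (hC : 0 < C) (n : ℕ)
    (v : ℕ → ℂ) (hv : ∀ k < n, ‖v k‖ ≤ C * A ^ k / k.factorial) :
    ∃ f ∈ expTypeClass A C, ∀ k < n, taylorCoeff f.toFun k = v k := by
  set p : Polynomial ℂ := ∑ k ∈ Finset.range n, Polynomial.monomial k (v k) with hp
  refine ⟨⟨fun z => p.eval z, p.differentiable⟩, fun z => ?_, fun k hk => ?_⟩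
  · simp only [hp, Polynomial.eval_finsetSum, Polynomial.eval_monomial]
    refine (norm_sum_le _ _).trans ?_
    have hexp := Real.sum_le_exp_of_nonneg (mul_nonneg hA.le (norm_nonneg z)) n
    refine le_trans ?_ (mul_le_mul_of_nonneg_left hexp hC.le)
    rw [Finset.mul_sum]
    refine Finset.sum_le_sum fun k hk => ?_
    rw [norm_mul, norm_pow]
    refine (mul_le_mul_of_nonneg_right (hv k (Finset.mem_range.1 hk)) (by positivity)).trans_eq ?_
    rw [mul_pow]
    ring
  · rw [taylorCoeff_polynomial, hp, Polynomial.finsetSum_coeff]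
    simp [Polynomial.coeff_monomial, hk]

/-- The lattice point of mesh `δ` with the given pair of natural coordinates. -/
noncomputable def gridPoint (δ : ℝ) (p : ℕ × ℕ) : ℂ :=
  ⟨δ * p.1, δ * p.2⟩

theorem norm_gridPoint_le {δ : ℝ} (hδ : 0 ≤ δ) (p : ℕ × ℕ) :
    ‖gridPoint δ p‖ ≤ δ * p.1 + δ * p.2 := by
  refine (Complex.norm_le_abs_re_add_abs_im _).trans_eq ?_
  simp only [gridPoint]
  rw [abs_of_nonneg (by positivity), abs_of_nonneg (by positivity)]

theorem le_norm_gridPoint_sub {δ : ℝ} (hδ : 0 ≤ δ) {p q : ℕ × ℕ} (h : p ≠ q) :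
    δ ≤ ‖gridPoint δ p - gridPoint δ q‖ := by
  have key : ∀ a b : ℕ, a ≠ b → δ ≤ |δ * a - δ * b| := by
    intro a b hab
    have h1 : (1 : ℝ) ≤ |(a : ℝ) - b| := by
      have : (1 : ℤ) ≤ |(a : ℤ) - b| := Int.one_le_abs (by omega)
      exact_mod_cast this
    rw [← mul_sub, abs_mul, abs_of_nonneg hδ]
    exact le_mul_of_one_le_right hδ h1
  by_cases h1 : p.1 = q.1
  · exact (key _ _ fun h2 => h (Prod.ext h1 h2)).trans
      (Complex.abs_im_le_norm (gridPoint δ p - gridPoint δ q))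
  · exact (key _ _ h1).trans (Complex.abs_re_le_norm (gridPoint δ p - gridPoint δ q))

theorem prod_le_epsCoveringNumber {A C ε : ℝ} (hA : 0 < A) (hC : 0 < C) (hε : 0 < ε)
    {X : Type*} [MetricSpace X] (Φ : expTypeClass A C → X) (hΦ : Isometry Φ) (n : ℕ) :
    ((∏ k ∈ Finset.range n, (⌊C * A ^ k / k.factorial / (6 * ε)⌋₊ + 1) ^ 2 : ℕ) : ℕ∞) ≤
      epsCoveringNumber ε (Set.range Φ) := by
  -- The mesh `3ε` exceeds the required separation `2ε`. Two coordinates up to `q k` give norm at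
  -- most `6ε * q k`, which must fit in the box.
  set q : ℕ → ℕ := fun k => ⌊C * A ^ k / k.factorial / (6 * ε)⌋₊ with hq
  have hcoord : ∀ (s : (k : Fin n) → Fin (q k + 1) × Fin (q k + 1)), ∃ f ∈ expTypeClass A C,
      ∀ k : Fin n, taylorCoeff f.toFun k = gridPoint (3 * ε) ((s k).1, (s k).2) := by
    intro s
    have hv : ∀ k < n, ‖if h : k < n then gridPoint (3 * ε) ((s ⟨k, h⟩).1, (s ⟨k, h⟩).2) else 0‖ ≤
        C * A ^ k / k.factorial := by
      intro k hk
      simp only [hk, dif_pos]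
      refine (norm_gridPoint_le (by positivity) _).trans ?_
      have hfl : (q k : ℝ) ≤ C * A ^ k / k.factorial / (6 * ε) := Nat.floor_le (by positivity)
      rw [le_div_iff₀ (by positivity)] at hfl
      have h1 : (((s ⟨k, hk⟩).1 : ℕ) : ℝ) ≤ q k := by
        exact_mod_cast Nat.lt_succ_iff.1 (s ⟨k, hk⟩).1.2
      have h2 : (((s ⟨k, hk⟩).2 : ℕ) : ℝ) ≤ q k := by
        exact_mod_cast Nat.lt_succ_iff.1 (s ⟨k, hk⟩).2.2
      nlinarith
    obtain ⟨f, hf, hfs⟩ := exists_mem_expTypeClass_taylorCoeff_eq hA hC n _ hv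
    exact ⟨f, hf, fun k => by simpa using hfs k k.2⟩
  choose F hF hFs using hcoord
  have hcard := card_le_epsCoveringNumber hε.le (K := Set.range Φ) (fun s => Φ ⟨F s, hF s⟩)
    (fun s => ⟨_, rfl⟩) ?_
  · convert hcard using 2
    simp only [Fintype.card_pi, Fintype.card_prod, Fintype.card_fin]
    rw [Finset.prod_range]
    simp only [sq, hq]
  · intro s t hst
    obtain ⟨k, hk⟩ := Function.ne_iff.1 hst
    simp only [hΦ.dist_eq, Subtype.dist_eq]
    refine lt_of_lt_of_le ?_ (EntireFunction.norm_taylorCoeff_sub_le_dist _ _ k)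
    rw [hFs, hFs]
    refine lt_of_lt_of_le (by linarith) (le_norm_gridPoint_sub (δ := 3 * ε) (by positivity) ?_)
    intro h
    rw [Prod.mk.injEq] at h
    exact hk (Prod.ext (Fin.ext h.1) (Fin.ext h.2))

theorem abs_sub_le_one_of_round_eq {x y : ℝ} (h : round x = round y) : |x - y| ≤ 1 := by
  have hx := abs_sub_round x
  have hy := abs_sub_round y
  rw [h] at hx
  rw [abs_le] at *
  constructor <;> linarith [hx.1, hx.2, hy.1, hy.2]

theorem round_mem_Icc {x B : ℝ} (h : |x| ≤ B) :
    round x ∈ Finset.Icc (-(⌊B + 1 / 2⌋₊ : ℤ)) ⌊B + 1 / 2⌋₊ := by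
  have hB : 0 ≤ B + 1 / 2 := by linarith [abs_nonneg x]
  have hr : |(round x : ℝ)| ≤ B + 1 / 2 := by
    have := abs_sub_round x
    rw [abs_le] at *
    constructor <;> linarith
  have h1 : (round x).natAbs ≤ ⌊B + 1 / 2⌋₊ := by
    rw [Nat.le_floor_iff hB, Nat.cast_natAbs, Int.cast_abs]
    exact hr
  rw [Finset.mem_Icc]
  omega

/-- The mesh `δ k = ε / 4 / 2 ^ k` makes the coefficient errors `2 * δ k` sum to `ε`, and `B k` is
Cauchy's bound in units of `δ k`. From `M` on, coefficients are at most `δ k` and need no code. -/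
theorem epsCoveringNumber_le_prod {A C ε r : ℝ} (hε : 0 < ε) (hr : 0 < r)
    {X : Type*} [MetricSpace X] (Φ : expTypeClass A C → X) (hΦ : Isometry Φ)
    {M : ℕ} (hM : ∀ k, M ≤ k → 4 * C * Real.exp (A * r) / ε * (2 / r) ^ k ≤ 1) :
    epsCoveringNumber ε (Set.range Φ) ≤
      ((∏ k ∈ Finset.range M,
        (2 * ⌊4 * C * Real.exp (A * r) / ε * (2 / r) ^ k + 1 / 2⌋₊ + 1) ^ 2 : ℕ) : ℕ∞) := by
  set B : ℕ → ℝ := fun k => 4 * C * Real.exp (A * r) / ε * (2 / r) ^ k with hB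
  set δ : ℕ → ℝ := fun k => ε / 4 / 2 ^ k with hδ
  have hδpos : ∀ k, 0 < δ k := fun k => by positivity
  have hcoef : ∀ (f : expTypeClass A C) (k : ℕ), ‖taylorCoeff f.1.toFun k‖ ≤ B k * δ k := by
    intro f k
    refine (norm_taylorCoeff_le f.1.differentiable hr (D := C * Real.exp (A * r))
      (fun z hz => hz ▸ f.2 z) k).trans_eq ?_
    simp only [hB, hδ, div_pow]
    field_simp
  have hre : ∀ (f : expTypeClass A C) (k : ℕ), |(taylorCoeff f.1.toFun k).re / δ k| ≤ B k := by
    intro f k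
    rw [abs_div, abs_of_pos (hδpos k), div_le_iff₀ (hδpos k)]
    exact (Complex.abs_re_le_norm _).trans (hcoef f k)
  have him : ∀ (f : expTypeClass A C) (k : ℕ), |(taylorCoeff f.1.toFun k).im / δ k| ≤ B k := by
    intro f k
    rw [abs_div, abs_of_pos (hδpos k), div_le_iff₀ (hδpos k)]
    exact (Complex.abs_im_le_norm _).trans (hcoef f k)
  let I : ℕ → Finset ℤ := fun k => Finset.Icc (-(⌊B k + 1 / 2⌋₊ : ℤ)) ⌊B k + 1 / 2⌋₊
  let c : expTypeClass A C → (k : Fin M) → I k × I k := fun f k =>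
    (⟨round ((taylorCoeff f.1.toFun k).re / δ k), round_mem_Icc (hre f k)⟩,
      ⟨round ((taylorCoeff f.1.toFun k).im / δ k), round_mem_Icc (him f k)⟩)
  refine (epsCoveringNumber_range_le_card Φ c fun f g hfg => ?_).trans_eq ?_
  · rw [hΦ.dist_eq, Subtype.dist_eq]
    refine EntireFunction.dist_le_of_hasSum (hasSum_geometric_two' ε) fun k => ?_
    have hu : ε / 2 / 2 ^ k = 2 * δ k := by simp only [hδ]; ring
    rw [hu]
    rcases lt_or_ge k M with hk | hk
    · have h := congrFun hfg ⟨k, hk⟩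
      simp only [c, Prod.mk.injEq, Subtype.mk.injEq] at h
      have h1 := abs_sub_le_one_of_round_eq h.1
      have h2 := abs_sub_le_one_of_round_eq h.2
      rw [← sub_div, abs_div, abs_of_pos (hδpos k), div_le_iff₀ (hδpos k)] at h1 h2
      refine (Complex.norm_le_abs_re_add_abs_im _).trans ?_
      rw [Complex.sub_re, Complex.sub_im]
      linarith
    · refine (norm_sub_le _ _).trans ?_
      have h1 := hcoef f k
      have h2 := hcoef g k
      have h3 : B k * δ k ≤ δ k := mul_le_of_le_one_left (hδpos k).le (hM k hk)
      linarith
  · congr 1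
    simp only [Fintype.card_pi, Fintype.card_prod, Fintype.card_coe, I, Int.card_Icc]
    rw [Finset.prod_range]
    refine Finset.prod_congr rfl fun k _ => ?_
    simp only [sq, hB]
    congr 1 <;> omega

theorem one_le_epsCoveringNumber {A C ε : ℝ} (hA : 0 < A) (hC : 0 < C) (hε : 0 < ε)
    {X : Type*} [MetricSpace X] (Φ : expTypeClass A C → X) (hΦ : Isometry Φ) :
    1 ≤ epsCoveringNumber ε (Set.range Φ) := by
  simpa using prod_le_epsCoveringNumber hA hC hε Φ hΦ 0

theorem epsCoveringNumber_ne_top {A C ε : ℝ} (hε : 0 < ε)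
    {X : Type*} [MetricSpace X] (Φ : expTypeClass A C → X) (hΦ : Isometry Φ) :
    epsCoveringNumber ε (Set.range Φ) ≠ ⊤ := by
  have hlim : Tendsto (fun k : ℕ => 4 * C * Real.exp (A * 4) / ε * (2 / 4 : ℝ) ^ k) atTop (𝓝 0) := by
    simpa using (tendsto_pow_atTop_nhds_zero_of_lt_one (by norm_num : (0 : ℝ) ≤ 2 / 4)
      (by norm_num)).const_mul (4 * C * Real.exp (A * 4) / ε)
  obtain ⟨M, hM⟩ := eventually_atTop.1 (hlim.eventually_le_const one_pos)
  exact ne_top_of_le_ne_top (ENat.natCast_ne_top _) (epsCoveringNumber_le_prod hε (by norm_num) Φ hΦ hM)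

/-! ### Entropy bounds with free parameters. -/

theorem metricEntropy_le {A C ε r : ℝ} (hA : 0 < A) (hC : 0 < C) (hε : 0 < ε) (hr : 2 < r)
    {X : Type*} [MetricSpace X] (Φ : expTypeClass A C → X) (hΦ : Isometry Φ) {P Q : ℝ}
    (hP : P = Real.logb 2 (4 * C * Real.exp (A * r) / ε)) (hQ : Q = Real.logb 2 (r / 2))
    (hP0 : 0 ≤ P) : metricEntropy ε (Set.range Φ) ≤ (P + 2) ^ 2 / Q + P + Q := by
  have hQ0 : 0 < Q := hQ ▸ Real.logb_pos (by norm_num) (by linarith)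
  have hlog : ∀ k : ℕ,
      Real.logb 2 (4 * C * Real.exp (A * r) / ε * (2 / r) ^ k) = P - Q * k := by
    intro k
    have h2 : (2 / r : ℝ) = (r / 2)⁻¹ := by rw [inv_div]
    rw [Real.logb_mul (by positivity) (by positivity), Real.logb_pow, h2, Real.logb_inv, ← hP, ← hQ]
    ring
  have hBpos : ∀ k : ℕ, 0 < 4 * C * Real.exp (A * r) / ε * (2 / r) ^ k := fun k => by positivity
  set M := ⌊P / Q⌋₊ + 1 with hMdef
  have hM : ∀ k, M ≤ k → 4 * C * Real.exp (A * r) / ε * (2 / r) ^ k ≤ 1 := by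
    intro k hk
    rw [← Real.logb_nonpos_iff (by norm_num : (1 : ℝ) < 2) (hBpos k), hlog]
    have h1 : P / Q < k := Nat.lt_of_floor_lt (by omega)
    rw [div_lt_iff₀ hQ0] at h1
    linarith
  have hN := ENat.toNat_le_toNat (epsCoveringNumber_le_prod hε (by linarith) Φ hΦ hM)
    (ENat.natCast_ne_top _)
  -- Monotonicity of the logarithm needs a positive covering number.
  have hN1 := ENat.toNat_le_toNat (one_le_epsCoveringNumber hA hC hε Φ hΦ)
    (epsCoveringNumber_ne_top hε Φ hΦ)
  rw [ENat.toNat_natCast] at hN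
  rw [ENat.toNat_one] at hN1
  have hsum : metricEntropy ε (Set.range Φ) ≤ ∑ k ∈ Finset.range M, 2 * (P + 2 - Q * k) := by
    refine (Real.logb_le_logb_of_le (by norm_num) (by exact_mod_cast hN1)
      (Nat.cast_le.2 hN)).trans ?_
    rw [Nat.cast_prod, Real.logb_prod _ _ fun k _ => by positivity]
    refine Finset.sum_le_sum fun k hk => ?_
    have hk' : (k : ℝ) ≤ P / Q := by
      rw [← Nat.le_floor_iff (by positivity)]
      have := Finset.mem_range.1 hk
      omega
    rw [le_div_iff₀ hQ0] at hk'
    -- Below `M` the bound is at least `1`, so the cell count per coordinate, at most `2B + 2`, is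
    -- at most `4B`; this is the `2` in `P + 2`.
    have hB1 : 1 ≤ 4 * C * Real.exp (A * r) / ε * (2 / r) ^ k := by
      rw [← Real.logb_nonneg_iff (by norm_num : (1 : ℝ) < 2) (hBpos k), hlog]
      linarith
    rw [Nat.cast_pow, Real.logb_pow]
    push_cast
    refine mul_le_mul_of_nonneg_left ?_ (by norm_num)
    have hfl := Nat.floor_le (show 0 ≤ 4 * C * Real.exp (A * r) / ε * (2 / r) ^ k + 1 / 2 by
      linarith)
    have h4 : Real.logb 2 ((2 : ℝ) ^ 2) = 2 := by
      rw [Real.logb_pow, Real.logb_self_eq_one (by norm_num)]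
      norm_num
    calc _ ≤ Real.logb 2 (2 ^ 2 * (4 * C * Real.exp (A * r) / ε * (2 / r) ^ k)) :=
          Real.logb_le_logb_of_le (by norm_num) (by positivity) (by linarith)
      _ = P + 2 - Q * k := by
          rw [Real.logb_mul (by norm_num) (hBpos k).ne', hlog, h4]
          ring
  have hgauss : ∀ n : ℕ, ∑ k ∈ Finset.range n, 2 * (P + 2 - Q * k) =
      2 * (P + 2) * n - Q * n ^ 2 + Q * n := by
    intro n
    induction n with
    | zero => simp
    | succ n ih => rw [Finset.sum_range_succ, ih]; push_cast; ring
  rw [hgauss] at hsum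
  -- Completing the square in `M`.
  have hsq : 2 * (P + 2) * M - Q * (M : ℝ) ^ 2 ≤ (P + 2) ^ 2 / Q := by
    rw [le_div_iff₀ hQ0]
    nlinarith [sq_nonneg (P + 2 - Q * M)]
  have hMle : Q * M ≤ P + Q := by
    have h1 := Nat.floor_le (show 0 ≤ P / Q by positivity)
    rw [le_div_iff₀ hQ0] at h1
    rw [hMdef]
    push_cast
    linarith
  linarith

theorem le_metricEntropy {A C ε : ℝ} (hA : 0 < A) (hC : 0 < C) (hε : 0 < ε)
    {X : Type*} [MetricSpace X] (Φ : expTypeClass A C → X) (hΦ : Isometry Φ) {n : ℕ} (hn : 0 < n) :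
    2 * n * Real.logb 2 (C / (6 * ε)) - n * (n - 1) * Real.logb 2 (n / A) ≤
      metricEntropy ε (Set.range Φ) := by
  have hn' : (0 : ℝ) < n := by exact_mod_cast hn
  -- Finiteness matters here, since `toNat` sends `⊤` to `0`.
  have hN := ENat.toNat_le_toNat (prod_le_epsCoveringNumber hA hC hε Φ hΦ n)
    (epsCoveringNumber_ne_top hε Φ hΦ)
  rw [ENat.toNat_natCast] at hN
  have hsum : ∑ k ∈ Finset.range n, 2 * (Real.logb 2 (C / (6 * ε)) - k * Real.logb 2 (n / A)) ≤
      metricEntropy ε (Set.range Φ) := by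
    refine le_trans ?_ (Real.logb_le_logb_of_le (by norm_num) ?_ (Nat.cast_le.2 hN))
    · rw [Nat.cast_prod, Real.logb_prod _ _ fun k _ => by positivity]
      refine Finset.sum_le_sum fun k hk => ?_
      rw [Nat.cast_pow, Real.logb_pow]
      push_cast
      refine mul_le_mul_of_nonneg_left ?_ (by norm_num)
      have hfact : (k.factorial : ℝ) ≤ (n : ℝ) ^ k := by
        have hkn := (Finset.mem_range.1 hk).le
        exact_mod_cast (Nat.factorial_le_pow k).trans (Nat.pow_le_pow_left hkn k)
      have hlow : C / (6 * ε) / (n / A) ^ k ≤ C * A ^ k / k.factorial / (6 * ε) := by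
        have h1 : C / (6 * ε) / (n / A) ^ k = C * A ^ k / n ^ k / (6 * ε) := by
          rw [div_pow]
          field_simp
        rw [h1]
        gcongr
      calc Real.logb 2 (C / (6 * ε)) - k * Real.logb 2 (n / A)
          = Real.logb 2 (C / (6 * ε) / (n / A) ^ k) := by
            rw [Real.logb_div (x := C / (6 * ε)) (y := (n / A) ^ k) (by positivity) (by positivity),
              Real.logb_pow]
        _ ≤ _ := Real.logb_le_logb_of_le (by norm_num) (by positivity)
            (hlow.trans (Nat.lt_floor_add_one _).le)
    · rw [Nat.cast_pos]
      exact Finset.prod_pos fun k _ => by positivity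
  have hgauss : ∀ m : ℕ, ∑ k ∈ Finset.range m,
      2 * (Real.logb 2 (C / (6 * ε)) - k * Real.logb 2 (n / A)) =
      2 * m * Real.logb 2 (C / (6 * ε)) - m * (m - 1) * Real.logb 2 (n / A) := by
    intro m
    induction m with
    | zero => simp
    | succ m ih => rw [Finset.sum_range_succ, ih]; push_cast; ring
  rwa [hgauss] at hsum

/-! ### Expansion of the two bounds. -/

theorem tendsto_logb_two_atTop : Tendsto (Real.logb 2) atTop atTop :=
  Real.tendsto_logb_atTop (by norm_num)

theorem eventually_mul_sq_logb_le (c : ℝ) : ∀ᶠ x : ℝ in atTop, c * Real.logb 2 x ^ 2 ≤ x := by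
  have hlog2 : 0 < Real.log 2 := Real.log_pos (by norm_num)
  have hc : 0 < |c| + 1 := by positivity
  have h := (Real.isLittleO_pow_log_id_atTop (n := 2)).bound
    (show 0 < Real.log 2 ^ 2 / (|c| + 1) by positivity)
  filter_upwards [h, eventually_ge_atTop 0] with x hx hx0
  rw [Real.norm_of_nonneg (sq_nonneg _), id, Real.norm_of_nonneg hx0, div_mul_eq_mul_div,
    le_div_iff₀ hc] at hx
  have h1 : Real.logb 2 x ^ 2 * (|c| + 1) ≤ x := by
    rw [Real.logb, div_pow, div_mul_eq_mul_div, div_le_iff₀ (by positivity)]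
    linarith
  nlinarith [le_abs_self c, sq_nonneg (Real.logb 2 x)]

/-- Upper estimate: the tangent-line bound at `r = L / l` as a multiple of `L ^ 2 / l`. -/
theorem tangent_bound_le {a L l m P : ℝ} (ha : 0 ≤ a) (hm : 1 ≤ m) (hml : 6 * m ^ 2 ≤ l)
    (hlL : (3 + a) * l ^ 2 ≤ L) (hP : P + 2 ≤ L * (1 + a / l)) (hP0 : 0 ≤ P) :
    (P + 2) ^ 2 / (l - m - 1) + P + (l - m - 1) ≤
      L ^ 2 / l * (1 + m / l + (3 + 2 * (2 * a + a ^ 2)) / l) := by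
  have hl : 6 ≤ l := by nlinarith
  have hl0 : 0 < l := by linarith
  have hml' : 6 * m ≤ l := by nlinarith
  have hQ : 0 < l - m - 1 := by linarith
  have hL : 0 < L := by nlinarith [mul_nonneg ha (sq_nonneg l)]
  -- After clearing denominators this is `(m + 1) * (m + 2) ≤ l`, which holds because `m ≥ 1` and `6
  -- * m ^ 2 ≤ l`.
  have hinv : 1 / (l - m - 1) ≤ 1 / l * (1 + (m + 2) / l) := by
    have h1 : 1 / l * (1 + (m + 2) / l) = (l + m + 2) / l ^ 2 := by field_simp; ring
    rw [h1, div_le_div_iff₀ hQ (by positivity)]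
    nlinarith
  have hsq : (1 + a / l) ^ 2 ≤ 1 + (2 * a + a ^ 2) / l := by
    have h1 : a ^ 2 / l ^ 2 ≤ a ^ 2 / l := by
      apply div_le_div_of_nonneg_left (sq_nonneg a) hl0
      nlinarith
    have h2 : (1 + a / l) ^ 2 = 1 + 2 * a / l + a ^ 2 / l ^ 2 := by field_simp; ring
    rw [h2, add_div]
    linarith
  set b := 2 * a + a ^ 2 with hb
  have hb0 : 0 ≤ b := by positivity
  have hmain : (P + 2) ^ 2 / (l - m - 1) ≤ L ^ 2 / l * (1 + m / l + (2 + 2 * b) / l) := by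
    have h1 : (P + 2) ^ 2 ≤ L ^ 2 * (1 + b / l) := by
      calc (P + 2) ^ 2 ≤ (L * (1 + a / l)) ^ 2 := pow_le_pow_left₀ (by linarith) hP 2
        _ = L ^ 2 * (1 + a / l) ^ 2 := by ring
        _ ≤ _ := mul_le_mul_of_nonneg_left hsq (sq_nonneg _)
    have h2 : (1 + b / l) * (1 + (m + 2) / l) ≤ 1 + m / l + (2 + 2 * b) / l := by
      have h3 : (m + 2) / l ≤ 1 := by rw [div_le_one hl0]; linarith
      have h4 : b / l * ((m + 2) / l) ≤ b / l := mul_le_of_le_one_right (by positivity) h3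
      have h5 : (1 + b / l) * (1 + (m + 2) / l) = 1 + (m + 2) / l + b / l + b / l * ((m + 2) / l) := by
        ring
      have h6 : 1 + m / l + (2 + 2 * b) / l = 1 + (m + 2) / l + b / l + b / l := by ring
      linarith
    calc (P + 2) ^ 2 / (l - m - 1) = (P + 2) ^ 2 * (1 / (l - m - 1)) := by ring
      _ ≤ L ^ 2 * (1 + b / l) * (1 / l * (1 + (m + 2) / l)) :=
          mul_le_mul h1 hinv (by positivity) (by positivity)
      _ = L ^ 2 / l * ((1 + b / l) * (1 + (m + 2) / l)) := by ring
      _ ≤ _ := mul_le_mul_of_nonneg_left h2 (by positivity)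
  have hrest : P + (l - m - 1) ≤ L ^ 2 / l * (1 / l) := by
    have h1 : a / l ≤ a := div_le_self ha (by linarith)
    have h2 : P + (l - m - 1) ≤ (3 + a) * L := by nlinarith [mul_nonneg ha (sq_nonneg l)]
    have h3 : L ^ 2 / l * (1 / l) = L ^ 2 / l ^ 2 := by field_simp
    rw [h3, le_div_iff₀ (by positivity)]
    nlinarith [sq_nonneg l]
  have : L ^ 2 / l * (1 + m / l + (3 + 2 * b) / l) =
      L ^ 2 / l * (1 + m / l + (2 + 2 * b) / l) + L ^ 2 / l * (1 / l) := by ring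
  linarith

/-- Lower estimate: the box bound at `n = ⌊L / (l - m)⌋` as a multiple of `L ^ 2 / l`. -/
theorem le_box_bound {b α L l m n t : ℝ} (hα : 0 ≤ α) (hm : 1 ≤ m)
    (hml : 6 * m ^ 2 ≤ l) (hlL : (2 + 4 * |b|) * l ^ 2 ≤ L) (hn1 : 1 ≤ n)
    (hn : n ≤ L / (l - m)) (hn' : L / (l - m) ≤ n + 1) (ht : t ≤ l - m + α) :
    L ^ 2 / l * (1 + m / l - (4 * α + 1) / l) ≤ 2 * n * (L + b) - n * (n - 1) * t := by
  have hl : 6 ≤ l := by nlinarith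
  have hl0 : 0 < l := by linarith
  have hml' : 6 * m ≤ l := by nlinarith
  have hw : 0 < l - m := by linarith
  have hL : 0 < L := by nlinarith [mul_nonneg (abs_nonneg b) (sq_nonneg l)]
  set w := l - m with hwdef
  set y := L / w with hy
  have hy0 : 0 < y := by positivity
  have hyw : y * w = L := div_mul_cancel₀ _ hw.ne'
  have hyl : y ≤ 2 * L / l := by
    rw [hy, div_le_div_iff₀ hw hl0]
    nlinarith
  -- The main term: `y * L = L ^ 2 / (l - m)`, and `(l + m) * (l - m) ≤ l ^ 2`.
  have hyL : L ^ 2 / l * (1 + m / l) ≤ y * L := by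
    have h1 : L ^ 2 / l * (1 + m / l) = L ^ 2 * (l + m) / l ^ 2 := by field_simp
    have h2 : y * L = L ^ 2 / w := by rw [hy]; ring
    rw [h1, h2, div_le_div_iff₀ (by positivity) hw]
    have : (l + m) * w ≤ l ^ 2 := by nlinarith [sq_nonneg m]
    nlinarith [mul_le_mul_of_nonneg_left this (sq_nonneg L)]
  have hquad : n * (n - 1) * t ≤ y * L + α * y ^ 2 := by
    calc n * (n - 1) * t ≤ n * (n - 1) * (w + α) :=
          mul_le_mul_of_nonneg_left ht (mul_nonneg (by linarith) (by linarith))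
      _ ≤ y ^ 2 * (w + α) := mul_le_mul_of_nonneg_right (by nlinarith) (by linarith)
      _ = y * (y * w) + α * y ^ 2 := by ring
      _ = _ := by rw [hyw]
  have hlin : 2 * y * L - 2 * L - 2 * |b| * y ≤ 2 * n * (L + b) := by
    have h1 : n * (-b) ≤ y * |b| :=
      (mul_le_mul_of_nonneg_left (neg_le_abs b) (by linarith)).trans
        (mul_le_mul_of_nonneg_right hn (abs_nonneg b))
    nlinarith
  have hy2 : α * y ^ 2 ≤ L ^ 2 / l * (4 * α / l) := by
    have h1 : y ^ 2 ≤ (2 * L / l) ^ 2 := pow_le_pow_left₀ hy0.le hyl 2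
    calc α * y ^ 2 ≤ α * (2 * L / l) ^ 2 := mul_le_mul_of_nonneg_left h1 hα
      _ = _ := by ring
  have hrest : 2 * L + 2 * |b| * y ≤ L ^ 2 / l * (1 / l) := by
    have h1 : L ^ 2 / l * (1 / l) = L ^ 2 / l ^ 2 := by field_simp
    have h2 : y ≤ 2 * L := hyl.trans (div_le_self (by linarith) (by linarith))
    have h3 : 2 * L + 2 * |b| * y ≤ (2 + 4 * |b|) * L := by nlinarith [abs_nonneg b]
    rw [h1, le_div_iff₀ (by positivity)]
    nlinarith [sq_nonneg l]
  have : L ^ 2 / l * (1 + m / l - (4 * α + 1) / l) =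
      L ^ 2 / l * (1 + m / l) - L ^ 2 / l * (4 * α / l) - L ^ 2 / l * (1 / l) := by ring
  linarith

/-! ### Choice of parameters and conclusion. -/

theorem tendsto_logb_two_inv_nhdsGT_zero :
    Tendsto (fun ε : ℝ => Real.logb 2 ε⁻¹) (𝓝[>] 0) atTop :=
  tendsto_logb_two_atTop.comp tendsto_inv_nhdsGT_zero

theorem eventually_metricEntropy_le {A C : ℝ} (hA : 0 < A) (hC : 0 < C)
    {X : Type*} [MetricSpace X] (Φ : expTypeClass A C → X) (hΦ : Isometry Φ) :
    ∃ K : ℝ, ∀ᶠ ε in 𝓝[>] (0 : ℝ), metricEntropy ε (Set.range Φ) ≤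
      iterLog 1 ε⁻¹ ^ 2 / iterLog 2 ε⁻¹ *
        (1 + iterLog 3 ε⁻¹ / iterLog 2 ε⁻¹ + K / iterLog 2 ε⁻¹) := by
  have hlog2 : 0 < Real.log 2 := Real.log_pos (by norm_num)
  set a := A / Real.log 2 with ha
  have ha0 : 0 < a := by positivity
  set b := Real.logb 2 (4 * C) with hb
  -- The slope is `a + 1`, not `a`: the extra `L / l` absorbs the constant `b + 2`.
  refine ⟨3 + 2 * (2 * (a + 1) + (a + 1) ^ 2), ?_⟩
  have hL := tendsto_logb_two_inv_nhdsGT_zero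
  have hl := tendsto_logb_two_atTop.comp hL
  have hm := tendsto_logb_two_atTop.comp hl
  filter_upwards [self_mem_nhdsWithin, hm.eventually_ge_atTop 1,
    hl.eventually (eventually_mul_sq_logb_le 6),
    hL.eventually (eventually_mul_sq_logb_le (3 + (a + 1))),
    hL.eventually (eventually_mul_sq_logb_le (|b| + 2))] with ε hε hm1 hml hlL hbL
  have hε0 : 0 < ε := hε
  simp only [Function.comp_apply] at hm1 hml
  simp only [iterLog, Function.iterate_succ, Function.iterate_zero, Function.comp_apply, id]
  set L := Real.logb 2 ε⁻¹ with hLdef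
  set l := Real.logb 2 L with hldef
  set m := Real.logb 2 l with hmdef
  have hl6 : 6 ≤ l := by nlinarith
  have hl0 : 0 < l := by linarith
  have hb0 := abs_nonneg b
  have hL0 : 0 < L := by nlinarith [mul_nonneg hb0 (sq_nonneg l)]
  have hr : 2 < L / l := by
    rw [lt_div_iff₀ hl0]
    nlinarith [mul_nonneg hb0 (sq_nonneg l)]
  have hP : Real.logb 2 (4 * C * Real.exp (A * (L / l)) / ε) = b + a * (L / l) + L := by
    rw [div_eq_mul_inv, Real.logb_mul (by positivity) (by positivity),
      Real.logb_mul (by positivity) (by positivity), ← hb, ← hLdef, Real.logb, Real.log_exp, ha]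
    ring
  have hQ : Real.logb 2 (L / l / 2) = l - m - 1 := by
    rw [Real.logb_div (by positivity) (by norm_num), Real.logb_div hL0.ne' hl0.ne',
      Real.logb_self_eq_one (by norm_num)]
  have hbl : b + 2 ≤ L / l := by
    rw [le_div_iff₀ hl0]
    nlinarith [mul_nonneg hb0 (sq_nonneg l), mul_nonneg hb0 hl0.le, le_abs_self b]
  have hP0 : 0 ≤ b + a * (L / l) + L := by
    have h1 : 0 ≤ a * (L / l) := by positivity
    have h2 : |b| + 2 ≤ L :=
      (le_mul_of_one_le_right (by linarith) (by nlinarith)).trans hbL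
    linarith [neg_abs_le b]
  refine (metricEntropy_le hA hC hε0 hr Φ hΦ hP.symm hQ.symm hP0).trans ?_
  refine tangent_bound_le (by positivity) hm1 hml hlL ?_ hP0
  have : L * (1 + (a + 1) / l) = L + a * (L / l) + L / l := by ring
  linarith

theorem eventually_le_metricEntropy {A C : ℝ} (hA : 0 < A) (hC : 0 < C)
    {X : Type*} [MetricSpace X] (Φ : expTypeClass A C → X) (hΦ : Isometry Φ) :
    ∃ K : ℝ, ∀ᶠ ε in 𝓝[>] (0 : ℝ), iterLog 1 ε⁻¹ ^ 2 / iterLog 2 ε⁻¹ *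
        (1 + iterLog 3 ε⁻¹ / iterLog 2 ε⁻¹ - K / iterLog 2 ε⁻¹) ≤
      metricEntropy ε (Set.range Φ) := by
  set b := Real.logb 2 (C / 6) with hb
  -- The `1` pays for `logb 2 (l - m) ≥ m - 1`, which follows from `l - m ≥ l / 2`; the other term
  -- pays for dividing `n` by `A`.
  set α := 1 + |Real.logb 2 A| with hα
  refine ⟨4 * α + 1, ?_⟩
  have hL := tendsto_logb_two_inv_nhdsGT_zero
  have hl := tendsto_logb_two_atTop.comp hL
  have hm := tendsto_logb_two_atTop.comp hl
  filter_upwards [self_mem_nhdsWithin, hm.eventually_ge_atTop 1,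
    hl.eventually (eventually_mul_sq_logb_le 6),
    hL.eventually (eventually_mul_sq_logb_le (2 + 4 * |b|))] with ε hε hm1 hml hlL
  have hε0 : 0 < ε := hε
  simp only [Function.comp_apply] at hm1 hml
  simp only [iterLog, Function.iterate_succ, Function.iterate_zero, Function.comp_apply, id]
  set L := Real.logb 2 ε⁻¹ with hLdef
  set l := Real.logb 2 L with hldef
  set m := Real.logb 2 l with hmdef
  have hl6 : 6 ≤ l := by nlinarith
  have hl0 : 0 < l := by linarith
  have hml' : 6 * m ≤ l := by nlinarith
  have hw : 0 < l - m := by linarith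
  have hlL' : 2 * l ^ 2 ≤ L := by nlinarith [mul_nonneg (abs_nonneg b) (sq_nonneg l)]
  have hL0 : 0 < L := by nlinarith
  have hy1 : 1 ≤ L / (l - m) := by
    rw [one_le_div hw]
    nlinarith
  set n := ⌊L / (l - m)⌋₊ with hn
  have hn0 : 0 < n := Nat.floor_pos.2 hy1
  have hn1 : (1 : ℝ) ≤ n := by exact_mod_cast hn0
  have hnle : (n : ℝ) ≤ L / (l - m) := Nat.floor_le (by linarith)
  have hlt : L / (l - m) ≤ n + 1 := (Nat.lt_floor_add_one _).le
  have ht : Real.logb 2 (n / A) ≤ l - m + α := by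
    have h1 : Real.logb 2 n ≤ l - Real.logb 2 (l - m) := by
      rw [hldef, ← Real.logb_div hL0.ne' hw.ne']
      exact Real.logb_le_logb_of_le (by norm_num) (by linarith) hnle
    have h2 : m - 1 ≤ Real.logb 2 (l - m) := by
      have h3 : Real.logb 2 (l / 2) = m - 1 := by
        rw [Real.logb_div hl0.ne' (by norm_num), Real.logb_self_eq_one (by norm_num)]
      rw [← h3]
      exact Real.logb_le_logb_of_le (by norm_num) (by linarith) (by linarith)
    rw [Real.logb_div (by positivity) hA.ne']
    linarith [neg_abs_le (Real.logb 2 A)]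
  have hLb : Real.logb 2 (C / (6 * ε)) = L + b := by
    rw [← div_div, div_eq_mul_inv (C / 6), Real.logb_mul (by positivity) (by positivity), add_comm]
  have hlow := le_metricEntropy hA hC hε0 Φ hΦ hn0
  rw [hLb] at hlow
  exact (le_box_bound (by positivity) hm1 hml hlL hn1 hnle hlt ht).trans hlow

theorem mainTheorem8 (A C : ℝ) (hA : 0 < A) (hC : 0 < C)
    {X : Type*} [MetricSpace X] (Φ : expTypeClass A C → X) (hΦ : Isometry Φ) :
    (∀ ε : ℝ, 0 < ε → epsCoveringNumber ε (Set.range Φ) ≠ ⊤) ∧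
    ∃ ρ : ℝ → ℝ,
      ρ =o[𝓝[>] (0 : ℝ)] (fun ε => iterLog 3 ε⁻¹ / iterLog 2 ε⁻¹) ∧
      ∀ᶠ ε in 𝓝[>] (0 : ℝ),
        metricEntropy ε (Set.range Φ) =
          iterLog 1 ε⁻¹ ^ 2 / iterLog 2 ε⁻¹ *
            (1 + iterLog 3 ε⁻¹ / iterLog 2 ε⁻¹ + ρ ε) := by
  refine ⟨fun ε hε => epsCoveringNumber_ne_top hε Φ hΦ, ?_⟩
  obtain ⟨K₁, hK₁⟩ := eventually_metricEntropy_le hA hC Φ hΦ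
  obtain ⟨K₂, hK₂⟩ := eventually_le_metricEntropy hA hC Φ hΦ
  have hL : Tendsto (fun ε : ℝ => iterLog 1 ε⁻¹) (𝓝[>] 0) atTop := tendsto_logb_two_inv_nhdsGT_zero
  have hl : Tendsto (fun ε : ℝ => iterLog 2 ε⁻¹) (𝓝[>] 0) atTop := tendsto_logb_two_atTop.comp hL
  have hm : Tendsto (fun ε : ℝ => iterLog 3 ε⁻¹) (𝓝[>] 0) atTop := tendsto_logb_two_atTop.comp hl
  -- The remainder is obtained by solving the expansion for it; the two entropy bounds make it
  -- `O(1/l)`.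
  refine ⟨fun ε => metricEntropy ε (Set.range Φ) / (iterLog 1 ε⁻¹ ^ 2 / iterLog 2 ε⁻¹) -
    (1 + iterLog 3 ε⁻¹ / iterLog 2 ε⁻¹), ?_, ?_⟩
  · have hO : (fun ε => metricEntropy ε (Set.range Φ) / (iterLog 1 ε⁻¹ ^ 2 / iterLog 2 ε⁻¹) -
        (1 + iterLog 3 ε⁻¹ / iterLog 2 ε⁻¹)) =O[𝓝[>] (0 : ℝ)]
        fun ε => 1 / iterLog 2 ε⁻¹ := by
      refine IsBigO.of_bound (max K₁ K₂) ?_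
      filter_upwards [hK₁, hK₂, hL.eventually_gt_atTop 0, hl.eventually_gt_atTop 0]
        with ε h1 h2 hL0 hl0
      have hD : 0 < iterLog 1 ε⁻¹ ^ 2 / iterLog 2 ε⁻¹ := by positivity
      rw [mul_comm, ← div_le_iff₀ hD] at h1
      rw [mul_comm, ← le_div_iff₀ hD] at h2
      rw [Real.norm_eq_abs, Real.norm_of_nonneg (by positivity), mul_one_div, abs_le]
      have h3 : K₁ / iterLog 2 ε⁻¹ ≤ max K₁ K₂ / iterLog 2 ε⁻¹ := by
        gcongr
        exact le_max_left _ _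
      have h4 : K₂ / iterLog 2 ε⁻¹ ≤ max K₁ K₂ / iterLog 2 ε⁻¹ := by
        gcongr
        exact le_max_right _ _
      constructor <;> linarith
    refine hO.trans_isLittleO ?_
    have h1 : (fun _ : ℝ => (1 : ℝ)) =o[𝓝[>] (0 : ℝ)] fun ε => iterLog 3 ε⁻¹ :=
      (isLittleO_const_left.2 (Or.inr (tendsto_norm_atTop_atTop.comp hm)))
    simpa only [div_eq_mul_inv] using
      h1.mul_isBigO (isBigO_refl (fun ε : ℝ => (iterLog 2 ε⁻¹)⁻¹) (𝓝[>] 0))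
  · filter_upwards [hL.eventually_gt_atTop 0, hl.eventually_gt_atTop 0] with ε hL0 hl0
    have hD : iterLog 1 ε⁻¹ ^ 2 / iterLog 2 ε⁻¹ ≠ 0 := by positivity
    rw [add_sub_cancel, mul_div_cancel₀ _ hD]
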